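/- Theorem (converse to Székely's bound). Let $G$ be a 2-coloring (red/blue) of the edges of the complete graph on $2^{2t}$ vertices, $t\in\mathbb N$, such that the maximum size of a monochromatic complete subgraph of $G$ is $(1+o(1))t$. Then at least one of the following two statements holds: 1. $G$ contains at least $2^{\frac12(4-\log_2 e-o(1))t^2}$ red monochromatic complete subgraphs of size at least $t$, and at least $2^{\frac12(4-\log_2 e-o(1))t^2}$ blue monochromatic complete subgraphs of size at least $(1-o(1))t$. 2. $G$ contains at least $2^{\frac12(4-\log_2 e-o(1))t^2}$ blue monochromatic complete subgraphs of size at least $t$, and at least $2^{\frac12(4-\log_2 e-o(1))t^2}$ red monochromatic complete subgraphs of size at least $(1-o(1))t$. Here $o(1)$ is as $t\to\infty$, uniformly in $G$. Explicitly: for every $\varepsilon>0$ there are $\delta>0$ and $t_0\in\mathbb N$ such that for every integer $t\ge t_0$ and every 2-coloring $G$ of the edges of the complete graph on $2^{2t}$ vertices whose largest monochromatic complete subgraph has size $m$ with $|m-t|\le\delta t$, one color has at least $2^{\frac12(4-\log_2 e-\varepsilon)t^2}$ monochromatic complete subgraphs of size at least $t$, and the other color has at least $2^{\frac12(4-\log_2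 e-\varepsilon)t^2}$ monochromatic complete subgraphs of size at least $(1-\varepsilon)t$. -/

import Mathlib

/-- A 2-coloring of the edges of the complete graph on `n` vertices;
`true` stands for red and `false` for blue. -/
abbrev TwoColoring (n : ℕ) : Type := SimpleGraph.TopEdgeLabeling (Fin n) Bool

/-- The vertex set `s` spans a monochromatic complete subgraph of color `c`: every two distinct
vertices of `s` are joined by an edge of color `c`. -/
def IsMonoClique {n : ℕ} (G : TwoColoring n) (c : Bool) (s : Finset (Fin n)) : Prop :=
  (SimpleGraph.EdgeLabeling.labelGraph G c).IsClique (s : Set (Fin n))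

/-- The largest number of vertices of a monochromatic complete subgraph (of either color). -/
noncomputable def maxMonoCliqueSize {n : ℕ} (G : TwoColoring n) : ℕ :=
  max (SimpleGraph.EdgeLabeling.labelGraph G true).cliqueNum
    (SimpleGraph.EdgeLabeling.labelGraph G false).cliqueNum

/-- The number of monochromatic complete subgraphs of color `c` with at least `x` vertices. -/
noncomputable def monoCliqueCount {n : ℕ} (G : TwoColoring n) (c : Bool) (x : ℝ) : ℕ :=
  {s : Finset (Fin n) | IsMonoClique G c s ∧ x ≤ (s.card : ℝ)}.ncard

/-!
The theorem follows from the exponential improvement of the Erdős–Szekeres bound for diagonal Ramsey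
numbers (Campos, Griffiths, Morris and Sahasrabudhe). By `exists_large_clique`, once `t` is large,
every two-coloring of the complete graph on `2 ^ (2 * t) = 4 ^ t` vertices has a monochromatic clique
with more than `(1 + 2⁻⁹⁰) t` vertices. Hence with `δ = 2⁻⁹⁰` the hypothesis on the largest
monochromatic clique is satisfied for boundedly many `t` only, and the two counts are asserted for no
coloring beyond `t₀`; this is a property of Ramsey numbers, and no count of cliques is carried out.

The improvement is proved by the method of Balister, Bollobás, Campos, Griffiths, Hurley, Morris,
Sahasrabudhe and Tiba. Its source is the geometric lemma `IsGramKernel.exists_many_pairs`: if `Z₁`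
and `Z₂` are Gram kernels on a finite set, then for some `r ≥ -1` a proportion
`exp (-10 - 9 √(r + 1))` of all pairs satisfies `Zᵢ ≥ r` for one of the kernels and `≥ -1` for the
other. All averages of products of powers of the kernels are nonnegative, hence so is that of
`Z₁ (2 + cosh √Z₂) + Z₂ (2 + cosh √Z₁)` (after scaling), which is at most `-1` outside the region
where both kernels are bounded below.

Applied to the normalized codegrees of the red and of the blue graph, the lemma yields
(`exists_density_step`) a vertex `x` such that passing to the neighbourhood of `x` costs almost
nothing in either color, or boosts the density of one color by a large amount. In the first case `x`
is added to the spine of a book; the second case is rare since densities are at most `1`. Balancing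
the two in `BookState.exists_book` produces a monochromatic clique of size `m`, a small constant
multiple of `t`, whose common neighbourhood in its own color has almost a proportion `2⁻ᵐ` of all
vertices. The Erdős–Szekeres bound allows only `binom (2t - m) t / binom (2t) t`, which is smaller by
a factor exponential in `m² / t`, and this is the contradiction.
-/

/-! ### Positive kernels and the geometric lemma -/

/-- A kernel on `V` that is a finite sum of squares `φ x * φ y`, i.e. a Gram kernel. -/
def IsGramKernel {V : Type*} (K : V → V → ℝ) : Prop :=
  ∃ (ι : Type) (_ : Fintype ι) (φ : ι → V → ℝ), ∀ x y, K x y = ∑ i, φ i x * φ i y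

namespace IsGramKernel

variable {V : Type*} {K L : V → V → ℝ}

lemma one : IsGramKernel (fun _ _ : V => (1 : ℝ)) :=
  ⟨Unit, inferInstance, fun _ _ => 1, by simp⟩

lemma mul (hK : IsGramKernel K) (hL : IsGramKernel L) :
    IsGramKernel (fun x y => K x y * L x y) := by
  obtain ⟨ι, _, φ, hφ⟩ := hK
  obtain ⟨κ, _, ψ, hψ⟩ := hL
  refine ⟨ι × κ, inferInstance, fun p x => φ p.1 x * ψ p.2 x, fun x y => ?_⟩
  beta_reduce
  rw [hφ, hψ, Finset.sum_mul_sum, Fintype.sum_prod_type]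
  refine Finset.sum_congr rfl fun i _ => Finset.sum_congr rfl fun j _ => ?_
  ring

lemma pow (hK : IsGramKernel K) (n : ℕ) : IsGramKernel (fun x y => K x y ^ n) := by
  induction n with
  | zero => simpa using one
  | succ n ih => simpa [pow_succ] using ih.mul hK

lemma const_mul (hK : IsGramKernel K) {c : ℝ} (hc : 0 ≤ c) :
    IsGramKernel (fun x y => c * K x y) := by
  obtain ⟨ι, _, φ, hφ⟩ := hK
  refine ⟨ι, inferInstance, fun i x => √c * φ i x, fun x y => ?_⟩
  beta_reduce
  rw [hφ, Finset.mul_sum]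
  refine Finset.sum_congr rfl fun i _ => ?_
  have := Real.mul_self_sqrt hc
  linear_combination (- φ i x * φ i y) * this

lemma sum_nonneg (hK : IsGramKernel K) (X : Finset V) : 0 ≤ ∑ x ∈ X, ∑ y ∈ X, K x y := by
  obtain ⟨ι, _, φ, hφ⟩ := hK
  have : ∑ x ∈ X, ∑ y ∈ X, K x y = ∑ i, (∑ x ∈ X, φ i x) ^ 2 := by
    simp_rw [hφ, sq, Finset.sum_mul_sum]
    rw [Finset.sum_comm]
    conv_rhs => rw [Finset.sum_comm]
    rw [Finset.sum_comm]
    refine Finset.sum_congr rfl fun x _ => ?_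
    rw [Finset.sum_comm]
  rw [this]
  positivity

end IsGramKernel

/-- The entire function `∑ xⁿ / (2n)!`, that is `cosh √x`, continued by `cos √(-x)` to negative
`x`. -/
noncomputable def coshSqrt (x : ℝ) : ℝ := if 0 ≤ x then Real.cosh √x else Real.cos √(-x)

lemma hasSum_coshSqrt (x : ℝ) : HasSum (fun n : ℕ => x ^ n / (2 * n).factorial) (coshSqrt x) := by
  unfold coshSqrt
  split_ifs with h
  · have := Real.hasSum_cosh √x
    simpa [pow_mul, Real.sq_sqrt h] using this
  · have := Real.hasSum_cos √(-x)
    have h' : 0 ≤ -x := by linarith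
    have hn : ∀ n : ℕ, (-1 : ℝ) ^ n * √(-x) ^ (2 * n) = x ^ n := fun n => by
      rw [pow_mul, Real.sq_sqrt h', ← mul_pow]; simp
    simpa only [hn] using this

lemma neg_one_le_coshSqrt (x : ℝ) : -1 ≤ coshSqrt x := by
  unfold coshSqrt
  split_ifs
  · linarith [Real.one_le_cosh √x]
  · exact Real.neg_one_le_cos _

lemma coshSqrt_le_one {x : ℝ} (hx : x ≤ 0) : coshSqrt x ≤ 1 := by
  unfold coshSqrt
  split_ifs with h
  · have : x = 0 := le_antisymm hx h
    simp [this]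
  · exact Real.cos_le_one _

lemma one_add_half_le_coshSqrt {x : ℝ} (hx : 0 ≤ x) : 1 + x / 2 ≤ coshSqrt x := by
  have h := hasSum_coshSqrt x
  have := sum_le_hasSum (Finset.range 2) (fun n _ => by positivity) h
  simpa [Finset.sum_range_succ] using this

lemma coshSqrt_le_exp {x M : ℝ} (hx : x ≤ M) : coshSqrt x ≤ Real.exp √M := by
  have h1 : 1 ≤ Real.exp √M := Real.one_le_exp (Real.sqrt_nonneg _)
  rcases le_total x 0 with h | h
  · exact (coshSqrt_le_one h).trans h1
  · have : coshSqrt x = Real.cosh √x := by simp [coshSqrt, h]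
    rw [this, Real.cosh_eq]
    have h2 : Real.exp √x ≤ Real.exp √M := Real.exp_le_exp.2 (Real.sqrt_le_sqrt hx)
    have h3 : Real.exp (-√x) ≤ 1 := Real.exp_le_one_iff.2 (by simp)
    linarith

/-- Every Taylor coefficient of `s * (2 + coshSqrt r)` is nonnegative, so its average against a
pair of Gram kernels is nonnegative. -/
lemma sum_mul_two_add_coshSqrt_nonneg {V : Type*} {K L : V → V → ℝ} (hK : IsGramKernel K)
    (hL : IsGramKernel L) (X : Finset V) :
    0 ≤ ∑ x ∈ X, ∑ y ∈ X, K x y * (2 + coshSqrt (L x y)) := by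
  have h : HasSum (fun n : ℕ => ∑ x ∈ X, ∑ y ∈ X, K x y * (L x y ^ n / (2 * n).factorial))
      (∑ x ∈ X, ∑ y ∈ X, K x y * coshSqrt (L x y)) :=
    hasSum_sum fun x _ => hasSum_sum fun y _ => (hasSum_coshSqrt (L x y)).mul_left _
  have h0 : 0 ≤ ∑ x ∈ X, ∑ y ∈ X, K x y * coshSqrt (L x y) := by
    refine h.nonneg fun n => ?_
    have := ((hK.mul (hL.pow n)).const_mul
      (c := ((2 * n).factorial : ℝ)⁻¹) (by positivity)).sum_nonneg X
    refine this.trans_eq (Finset.sum_congr rfl fun x _ => Finset.sum_congr rfl fun y _ => ?_)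
    rw [div_eq_mul_inv]; ring
  have h1 := hK.sum_nonneg X
  have : ∑ x ∈ X, ∑ y ∈ X, K x y * (2 + coshSqrt (L x y)) =
      2 * ∑ x ∈ X, ∑ y ∈ X, K x y + ∑ x ∈ X, ∑ y ∈ X, K x y * coshSqrt (L x y) := by
    simp only [Finset.mul_sum, ← Finset.sum_add_distrib]
    refine Finset.sum_congr rfl fun x _ => Finset.sum_congr rfl fun y _ => ?_
    ring
  rw [this]; linarith

/-- The test function of the geometric lemma. -/
noncomputable def testFun (x y : ℝ) : ℝ := x * (2 + coshSqrt y) + y * (2 + coshSqrt x)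

lemma testFun_comm (x y : ℝ) : testFun x y = testFun y x := by unfold testFun; ring

lemma testFun_le_neg_one_of_left {x y : ℝ} (hx : x < -6) : testFun x y ≤ -1 := by
  unfold testFun
  have a1 := neg_one_le_coshSqrt x
  have a2 := neg_one_le_coshSqrt y
  have a3 := coshSqrt_le_one (x := x) (by linarith)
  rcases le_total y 0 with hy | hy
  · nlinarith
  · have a4 := one_add_half_le_coshSqrt hy
    nlinarith

lemma testFun_le_exp {x y M : ℝ} (hx : x ≤ M) (hy : y ≤ M) (hM : 0 ≤ M) :
    testFun x y ≤ Real.exp (3 * √M) := by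
  have b1 := coshSqrt_le_exp hx
  have b2 := coshSqrt_le_exp hy
  have a1 := neg_one_le_coshSqrt x
  have a2 := neg_one_le_coshSqrt y
  set s := √M
  have hs : 0 ≤ s := Real.sqrt_nonneg _
  have hMs : M = s ^ 2 := (Real.sq_sqrt hM).symm
  have h1 : 1 ≤ Real.exp s := Real.one_le_exp hs
  have h2 : testFun x y ≤ 6 * M * Real.exp s := by
    unfold testFun
    have : x * (2 + coshSqrt y) ≤ M * (3 * Real.exp s) := by
      have := mul_le_mul_of_nonneg_right hx (show (0:ℝ) ≤ 2 + coshSqrt y by linarith)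
      have := mul_le_mul_of_nonneg_left (show 2 + coshSqrt y ≤ 3 * Real.exp s by linarith) hM
      linarith
    have : y * (2 + coshSqrt x) ≤ M * (3 * Real.exp s) := by
      have := mul_le_mul_of_nonneg_right hy (show (0:ℝ) ≤ 2 + coshSqrt x by linarith)
      have := mul_le_mul_of_nonneg_left (show 2 + coshSqrt x ≤ 3 * Real.exp s by linarith) hM
      linarith
    linarith
  -- `s ≤ exp (s - 1)` gives `6 s² ≤ 6 e⁻² e^{2s} ≤ e^{2s}`
  have h3 : s ≤ Real.exp (s - 1) := by linarith [Real.add_one_le_exp (s - 1)]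
  have h4 : s ^ 2 ≤ Real.exp (2 * s) * Real.exp (-2) := by
    rw [← Real.exp_add]
    calc s ^ 2 ≤ Real.exp (s - 1) ^ 2 := by gcongr
      _ = Real.exp (2 * s + -2) := by rw [← Real.exp_nat_mul]; congr 1; push_cast; ring
  have h5 : 6 * Real.exp (-2) ≤ 1 := by
    have e1 : (2.7 : ℝ) ≤ Real.exp 1 := by linarith [Real.exp_one_gt_d9]
    have e2 : Real.exp 2 = Real.exp 1 ^ 2 := by rw [← Real.exp_nat_mul]; norm_num
    rw [Real.exp_neg, ← div_eq_mul_inv, div_le_one (Real.exp_pos _), e2]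
    nlinarith
  calc testFun x y ≤ 6 * M * Real.exp s := h2
    _ ≤ Real.exp (2 * s) * Real.exp s := by
        gcongr
        rw [hMs]
        nlinarith [Real.exp_pos (2 * s)]
    _ = Real.exp (3 * s) := by rw [← Real.exp_add]; congr 1; ring

/-- **Geometric lemma**. For two Gram kernels, a noticeable proportion of all pairs has one kernel
value at least `r` and the other one at least `-1`. The point is the dependence on `r`: the
proportion decays only like `exp (-9 √(r + 1))`. -/
theorem IsGramKernel.exists_many_pairs {V : Type*} (Z : Bool → V → V → ℝ)
    (hZ : ∀ i, IsGramKernel (Z i)) (X : Finset V) (hX : X.Nonempty) :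
    ∃ r : ℝ, -1 ≤ r ∧ ∃ i : Bool,
      Real.exp (-10 - 9 * √(r + 1)) * (X.card : ℝ) ^ 2 ≤
        (((X ×ˢ X).filter fun q => r ≤ Z i q.1 q.2 ∧ -1 ≤ Z (!i) q.1 q.2).card : ℝ) := by
  classical
  by_contra! hcon
  set n2 : ℝ := (X.card : ℝ) ^ 2 with hn2
  have hn2pos : 0 < n2 := by have := hX.card_pos; positivity
  set P := X ×ˢ X
  have hP : (P.card : ℝ) = n2 := by simp [P, hn2, sq]
  set E := P.filter fun q => -1 ≤ Z true q.1 q.2 ∧ -1 ≤ Z false q.1 q.2 with hE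
  set s : V × V → ℝ := fun q => √(max (Z true q.1 q.2) (Z false q.1 q.2) + 1) with hs
  set F : V × V → ℝ := fun q => testFun (6 * Z true q.1 q.2) (6 * Z false q.1 q.2) with hF
  have h0 : 0 ≤ ∑ q ∈ P, F q := by
    have e1 := sum_mul_two_add_coshSqrt_nonneg ((hZ true).const_mul (c := 6) (by norm_num))
      ((hZ false).const_mul (c := 6) (by norm_num)) X
    have e2 := sum_mul_two_add_coshSqrt_nonneg ((hZ false).const_mul (c := 6) (by norm_num))
      ((hZ true).const_mul (c := 6) (by norm_num)) X
    rw [Finset.sum_product]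
    simp only [hF, testFun, Finset.sum_add_distrib]
    linarith
  have hbad : ∑ q ∈ P \ E, F q ≤ -((P \ E).card : ℝ) := by
    have : ∀ q ∈ P \ E, F q ≤ -1 := by
      intro q hq
      simp only [hE, Finset.mem_sdiff, Finset.mem_filter, not_and, not_le] at hq
      by_cases h : -1 ≤ Z true q.1 q.2
      · have := hq.2 hq.1 h
        simp only [hF]
        rw [testFun_comm]
        exact testFun_le_neg_one_of_left (by linarith)
      · push Not at h
        exact testFun_le_neg_one_of_left (by linarith)
    have := Finset.sum_le_sum this
    simpa using this
  have hgood : ∀ q ∈ E, F q ≤ Real.exp 8 * Real.exp (8 * (⌊s q⌋₊ : ℝ)) := by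
    intro q hq
    simp only [hE, Finset.mem_filter] at hq
    set M := max (Z true q.1 q.2) (Z false q.1 q.2) with hM
    have hM1 : 0 ≤ M + 1 := by have := le_max_left (Z true q.1 q.2) (Z false q.1 q.2); linarith
    have h1 : F q ≤ Real.exp (3 * √(6 * (M + 1))) := by
      refine testFun_le_exp ?_ ?_ (by positivity)
      · have := le_max_left (Z true q.1 q.2) (Z false q.1 q.2); linarith
      · have := le_max_right (Z true q.1 q.2) (Z false q.1 q.2); linarith
    refine h1.trans ?_
    rw [← Real.exp_add]
    apply Real.exp_le_exp.2
    have h2 : √(6 * (M + 1)) = √6 * s q := Real.sqrt_mul (by norm_num) _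
    have h3 : √6 ≤ 2.5 := Real.sqrt_le_iff.2 (by norm_num)
    have h4 : s q < ⌊s q⌋₊ + 1 := Nat.lt_floor_add_one _
    have h5 : 0 ≤ s q := Real.sqrt_nonneg _
    rw [h2]
    nlinarith
  have hfib : ∀ k : ℕ, ((E.filter fun q => ⌊s q⌋₊ = k).card : ℝ) ≤
      2 * (Real.exp (-10 - 9 * k) * n2) := by
    intro k
    have hr : -1 ≤ (k : ℝ) ^ 2 - 1 := by nlinarith
    have hk : √((k : ℝ) ^ 2 - 1 + 1) = k := by simp
    have c1 := (hcon _ hr true).le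
    have c2 := (hcon _ hr false).le
    rw [hk] at c1 c2
    have hsub : (E.filter fun q => ⌊s q⌋₊ = k) ⊆
        (P.filter fun q => (k : ℝ) ^ 2 - 1 ≤ Z true q.1 q.2 ∧ -1 ≤ Z (!true) q.1 q.2) ∪
        (P.filter fun q => (k : ℝ) ^ 2 - 1 ≤ Z false q.1 q.2 ∧ -1 ≤ Z (!false) q.1 q.2) := by
      intro q hq
      simp only [hE, Finset.mem_filter] at hq
      obtain ⟨⟨hqP, h1, h2⟩, h3⟩ := hq
      have h4 : (k : ℝ) ≤ s q := by
        rw [← h3]; exact Nat.floor_le (Real.sqrt_nonneg _)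
      have h5 : (k : ℝ) ^ 2 ≤ max (Z true q.1 q.2) (Z false q.1 q.2) + 1 := by
        have h6 : 0 ≤ max (Z true q.1 q.2) (Z false q.1 q.2) + 1 := by
          have := le_max_left (Z true q.1 q.2) (Z false q.1 q.2); linarith
        calc (k : ℝ) ^ 2 ≤ s q ^ 2 := by gcongr
          _ = _ := Real.sq_sqrt h6
      simp only [Finset.mem_union, Finset.mem_filter, Bool.not_true, Bool.not_false]
      rcases max_choice (Z true q.1 q.2) (Z false q.1 q.2) with h | h <;> rw [h] at h5
      · left; exact ⟨hqP, by linarith, h2⟩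
      · right; exact ⟨hqP, by linarith, h1⟩
    have h6 := (Finset.card_le_card hsub).trans (Finset.card_union_le _ _)
    have h7 : ((E.filter fun q => ⌊s q⌋₊ = k).card : ℝ) ≤ _ := Nat.cast_le.2 h6
    push_cast at h7
    linarith
  -- summing the geometric series over the integer parts of `s`
  obtain ⟨N, hN⟩ : ∃ N : ℕ, ∀ q ∈ E, ⌊s q⌋₊ ∈ Finset.range N := by
    refine ⟨E.sup (fun q => ⌊s q⌋₊) + 1, fun q hq => ?_⟩
    exact Finset.mem_range.2 (Nat.lt_succ_of_le (Finset.le_sup (f := fun q => ⌊s q⌋₊) hq))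
  have hgeo : ∑ k ∈ Finset.range N, Real.exp (-1) ^ k ≤ 2 := by
    have hlt : Real.exp (-1) ≤ 1 / 2 := by
      rw [Real.exp_neg, one_div]
      exact inv_anti₀ (by norm_num) (by linarith [Real.exp_one_gt_d9])
    have hs := summable_geometric_of_lt_one (Real.exp_pos (-1)).le (by linarith)
    refine (hs.sum_le_tsum _ (fun _ _ => by positivity)).trans ?_
    rw [tsum_geometric_of_lt_one (Real.exp_pos (-1)).le (by linarith)]
    exact inv_le_of_inv_le₀ (by norm_num) (by linarith)
  have hsumE : ∑ q ∈ E, F q ≤ 4 * Real.exp (-2) * n2 := by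
    calc ∑ q ∈ E, F q ≤ ∑ q ∈ E, Real.exp 8 * Real.exp (8 * (⌊s q⌋₊ : ℝ)) :=
          Finset.sum_le_sum hgood
      _ = ∑ k ∈ Finset.range N, ∑ q ∈ E.filter (fun q => ⌊s q⌋₊ = k),
            Real.exp 8 * Real.exp (8 * (⌊s q⌋₊ : ℝ)) := (Finset.sum_fiberwise_of_maps_to hN _).symm
      _ = ∑ k ∈ Finset.range N, ((E.filter fun q => ⌊s q⌋₊ = k).card : ℝ) *
            (Real.exp 8 * Real.exp (8 * (k : ℝ))) := by
          refine Finset.sum_congr rfl fun k _ => ?_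
          rw [Finset.sum_congr rfl (g := fun _ => Real.exp 8 * Real.exp (8 * (k : ℝ)))]
          · simp
          · intro q hq; rw [(Finset.mem_filter.1 hq).2]
      _ ≤ ∑ k ∈ Finset.range N, (2 * (Real.exp (-10 - 9 * k) * n2)) *
            (Real.exp 8 * Real.exp (8 * (k : ℝ))) := by
          gcongr with k _
          exact hfib k
      _ = (2 * Real.exp (-2) * n2) * ∑ k ∈ Finset.range N, Real.exp (-1) ^ k := by
          rw [Finset.mul_sum]
          refine Finset.sum_congr rfl fun k _ => ?_
          have : Real.exp (-10 - 9 * k) * (Real.exp 8 * Real.exp (8 * (k : ℝ))) =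
              Real.exp (-2) * Real.exp (-1) ^ k := by
            rw [← Real.exp_nat_mul, ← Real.exp_add, ← Real.exp_add, ← Real.exp_add]
            congr 1; ring
          linear_combination 2 * n2 * this
      _ ≤ (2 * Real.exp (-2) * n2) * 2 := by gcongr
      _ = _ := by ring
  have hEcard : (E.card : ℝ) ≤ Real.exp (-10) * n2 := by
    have := (hcon (-1) le_rfl true).le
    simpa [hE] using this
  have hsplit : ∑ q ∈ P \ E, F q + ∑ q ∈ E, F q = ∑ q ∈ P, F q :=
    Finset.sum_sdiff (Finset.filter_subset _ _)
  have hcard : ((P \ E).card : ℝ) + E.card = n2 := by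
    rw [← hP]; exact_mod_cast Finset.card_sdiff_add_card_eq_card (Finset.filter_subset _ _)
  have e1 : (2.7 : ℝ) ≤ Real.exp 1 := by linarith [Real.exp_one_gt_d9]
  have e2 : Real.exp (-2) ≤ 1 / 7 := by
    have e2 : Real.exp 2 = Real.exp 1 ^ 2 := by rw [← Real.exp_nat_mul]; norm_num
    rw [Real.exp_neg, one_div]
    exact inv_anti₀ (by norm_num) (by rw [e2]; nlinarith)
  have e3 : Real.exp (-10) ≤ Real.exp (-2) := Real.exp_le_exp.2 (by norm_num)
  nlinarith

/-! ### One step of the book algorithm -/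

open Classical in
/-- The neighbours of `x` inside `Y` in the graph of color `i`. -/
noncomputable def nbhd {V : Type} (H : Bool → SimpleGraph V) (i : Bool) (x : V) (Y : Finset V) :
    Finset V :=
  Y.filter fun y => (H i).Adj x y

@[simp]
lemma mem_nbhd {V : Type} {H : Bool → SimpleGraph V} {i : Bool} {x y : V} {Y : Finset V} :
    y ∈ nbhd H i x Y ↔ y ∈ Y ∧ (H i).Adj x y := by
  simp [nbhd]

lemma nbhd_subset {V : Type} (H : Bool → SimpleGraph V) (i : Bool) (x : V) (Y : Finset V) :
    nbhd H i x Y ⊆ Y := fun _ h => (mem_nbhd.1 h).1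

section Step

variable {V : Type} [DecidableEq V]

/-- The Gram kernel measuring the deviation of the codegree `|N x ∩ N y|` in `Y` from its expected
value `|N x| |N y| / |Y|`, in units of `s` times that value. -/
noncomputable def codegreeKernel (N : V → Finset V) (Y : Finset V) (s : ℝ) (x y : V) : ℝ :=
  ((Y.card : ℝ) * s)⁻¹ * ∑ v : Y,
    ((if (v : V) ∈ N x then (Y.card : ℝ) / (N x).card else 0) - 1) *
    ((if (v : V) ∈ N y then (Y.card : ℝ) / (N y).card else 0) - 1)

lemma isGramKernel_codegreeKernel (N : V → Finset V) (Y : Finset V) {s : ℝ} (hs : 0 ≤ s) :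
    IsGramKernel (codegreeKernel N Y s) :=
  IsGramKernel.const_mul ⟨Y, inferInstance,
    fun v x => (if (v : V) ∈ N x then (Y.card : ℝ) / (N x).card else 0) - 1, fun _ _ => rfl⟩
    (by positivity)

lemma codegreeKernel_eq {N : V → Finset V} {Y : Finset V} {s : ℝ} {x y : V} (hs : 0 < s)
    (hx : N x ⊆ Y) (hy : N y ⊆ Y) (hx0 : (N x).Nonempty) (hy0 : (N y).Nonempty) :
    codegreeKernel N Y s x y =
      (((N x ∩ N y).card : ℝ) * Y.card / ((N x).card * (N y).card) - 1) / s := by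
  have hY : (0 : ℝ) < Y.card := by exact_mod_cast (hx0.mono hx).card_pos
  have hxc : (0 : ℝ) < (N x).card := by exact_mod_cast hx0.card_pos
  have hyc : (0 : ℝ) < (N y).card := by exact_mod_cast hy0.card_pos
  have key : ∀ A : Finset V, A ⊆ Y → ∑ v ∈ Y, (if v ∈ A then (1 : ℝ) else 0) = A.card := by
    intro A hA
    rw [Finset.sum_ite_mem, Finset.inter_eq_right.2 hA]
    simp
  have hsum : ∑ v ∈ Y, ((if v ∈ N x then (Y.card : ℝ) / (N x).card else 0) - 1) *
      ((if v ∈ N y then (Y.card : ℝ) / (N y).card else 0) - 1) =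
      (Y.card : ℝ) ^ 2 / ((N x).card * (N y).card) * (N x ∩ N y).card - Y.card := by
    have : ∀ v ∈ Y, ((if v ∈ N x then (Y.card : ℝ) / (N x).card else 0) - 1) *
      ((if v ∈ N y then (Y.card : ℝ) / (N y).card else 0) - 1) =
      (Y.card : ℝ) ^ 2 / ((N x).card * (N y).card) * (if v ∈ N x ∩ N y then (1 : ℝ) else 0)
        - Y.card / (N x).card * (if v ∈ N x then (1 : ℝ) else 0)
        - Y.card / (N y).card * (if v ∈ N y then (1 : ℝ) else 0) + 1 := by
      intro v _
      by_cases h1 : v ∈ N x <;> by_cases h2 : v ∈ N y <;> simp [h1, h2]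
      · field_simp
        ring
      · ring
      · ring
    rw [Finset.sum_congr rfl this, Finset.sum_add_distrib, Finset.sum_sub_distrib,
      Finset.sum_sub_distrib, ← Finset.mul_sum, ← Finset.mul_sum, ← Finset.mul_sum, key _ hx,
      key _ hy, key _ (Finset.inter_subset_left.trans hx)]
    field_simp
    simp
    ring
  rw [codegreeKernel, Finset.sum_coe_sort Y (fun v =>
    ((if v ∈ N x then (Y.card : ℝ) / (N x).card else 0) - 1) *
      ((if v ∈ N y then (Y.card : ℝ) / (N y).card else 0) - 1)), hsum]
  field_simp

/-- A lower bound on the codegree kernel is a lower bound on the density of `N y` in `N x`. -/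
lemma le_card_inter_of_le_codegreeKernel {N : V → Finset V} {Y : Finset V} {d a r : ℝ} {x y : V}
    (hd : 0 < d) (ha : 0 < a) (had : a ≤ d) (hr : -1 ≤ r) (hY : Y.Nonempty)
    (hx : N x ⊆ Y) (hy : N y ⊆ Y) (hdx : d * Y.card ≤ (N x).card) (hdy : d * Y.card ≤ (N y).card)
    (h : r ≤ codegreeKernel N Y (a / d) x y) :
    (d + r * a) * (N x).card ≤ ((N x ∩ N y).card : ℝ) := by
  have hY : (0 : ℝ) < Y.card := by exact_mod_cast hY.card_pos
  have hxc : (0 : ℝ) < (N x).card := lt_of_lt_of_le (by positivity) hdx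
  have hyc : (0 : ℝ) < (N y).card := lt_of_lt_of_le (by positivity) hdy
  rw [codegreeKernel_eq (by positivity) hx hy (Finset.card_pos.1 (by exact_mod_cast hxc))
    (Finset.card_pos.1 (by exact_mod_cast hyc)), le_div_iff₀ (by positivity), le_sub_iff_add_le,
    le_div_iff₀ (by positivity)] at h
  have h1 : 0 ≤ r * (a / d) + 1 := by
    have : a / d ≤ 1 := (div_le_one hd).2 had
    have : 0 ≤ a / d := by positivity
    nlinarith
  have h2 : (r * (a / d) + 1) * ((N x).card * (d * Y.card)) ≤ ((N x ∩ N y).card : ℝ) * Y.card :=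
    (by gcongr : _ ≤ (r * (a / d) + 1) * ((N x).card * (N y).card)).trans h
  have h3 : (r * (a / d) + 1) * ((N x).card * (d * Y.card)) =
      ((d + r * a) * (N x).card) * Y.card := by
    field_simp; ring
  rw [h3] at h2
  exact le_of_mul_le_mul_right h2 hY

lemma nbhd_nbhd (H : Bool → SimpleGraph V) (i : Bool) (x y : V) (Y : Finset V) :
    nbhd H i y (nbhd H i x Y) = nbhd H i x Y ∩ nbhd H i y Y := by
  ext v; simp; tauto

/-- Passing to the neighbourhood of a suitable vertex `x ∈ X`, many vertices of `X` gain density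
`r * a i` in one color `i` while losing at most `a (!i)` in the other one. -/
theorem exists_density_step (H : Bool → SimpleGraph V) (X : Finset V) (hX : X.Nonempty)
    (Y : Bool → Finset V) (hY : ∀ i, (Y i).Nonempty) (d a : Bool → ℝ) (hd : ∀ i, 0 < d i)
    (ha : ∀ i, 0 < a i) (had : ∀ i, a i ≤ d i)
    (hdeg : ∀ i, ∀ x ∈ X, d i * (Y i).card ≤ (nbhd H i x (Y i)).card) :
    ∃ r : ℝ, -1 ≤ r ∧ ∃ i : Bool, ∃ x ∈ X, ∃ X' ⊆ X,
      Real.exp (-10 - 9 * √(r + 1)) * X.card ≤ X'.card ∧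
      (∀ y ∈ X', (d i + r * a i) * (nbhd H i x (Y i)).card ≤
        (nbhd H i y (nbhd H i x (Y i))).card) ∧
      (∀ y ∈ X', (d (!i) - a (!i)) * (nbhd H (!i) x (Y (!i))).card ≤
        (nbhd H (!i) y (nbhd H (!i) x (Y (!i)))).card) := by
  classical
  set Z : Bool → V → V → ℝ := fun i =>
    codegreeKernel (fun x => nbhd H i x (Y i)) (Y i) (a i / d i) with hZ
  obtain ⟨r, hr, i, hi⟩ := IsGramKernel.exists_many_pairs Z
    (fun i => isGramKernel_codegreeKernel _ _ (div_pos (ha i) (hd i)).le) X hX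
  set c := Real.exp (-10 - 9 * √(r + 1))
  set W : V → Finset V := fun x => X.filter fun y => r ≤ Z i x y ∧ -1 ≤ Z (!i) x y with hW
  obtain ⟨x, hx, hxW⟩ : ∃ x ∈ X, c * X.card ≤ ((W x).card : ℝ) := by
    apply Finset.exists_le_of_sum_le hX
    refine le_trans ?_ (hi.trans_eq ?_)
    · rw [Finset.sum_const, nsmul_eq_mul]; apply le_of_eq; ring
    · rw [Finset.card_filter, Finset.sum_product, Nat.cast_sum]
      refine Finset.sum_congr rfl fun x _ => ?_
      rw [hW, Finset.card_filter]
  refine ⟨r, hr, i, x, hx, W x, Finset.filter_subset _ _, hxW, fun y hy => ?_, fun y hy => ?_⟩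
  · obtain ⟨hyX, h1, -⟩ := Finset.mem_filter.1 hy
    rw [nbhd_nbhd]
    exact le_card_inter_of_le_codegreeKernel (N := fun x => nbhd H i x (Y i)) (hd i) (ha i)
      (had i) hr (hY i) (nbhd_subset _ _ _ _) (nbhd_subset _ _ _ _) (hdeg i x hx) (hdeg i y hyX) h1
  · obtain ⟨hyX, -, h1⟩ := Finset.mem_filter.1 hy
    rw [nbhd_nbhd]
    have := le_card_inter_of_le_codegreeKernel (N := fun x => nbhd H (!i) x (Y (!i))) (hd (!i))
      (ha (!i)) (had (!i)) le_rfl (hY (!i)) (nbhd_subset _ _ _ _) (nbhd_subset _ _ _ _)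
      (hdeg (!i) x hx) (hdeg (!i) y hyX) h1
    simpa [sub_eq_add_neg] using this

end Step

/-! ### Books in two-colored graphs -/

lemma half_le_log_one_add {u : ℝ} (hu : 0 ≤ u) (hu1 : u ≤ 1) : u / 2 ≤ Real.log (1 + u) := by
  refine le_trans ?_ (Real.one_sub_inv_le_log_of_pos (by linarith))
  rw [le_sub_iff_add_le, inv_eq_one_div, ← le_sub_iff_add_le', div_le_iff₀ (by linarith)]
  nlinarith

/-- The loss `10 + 9 √(r + 1)` in the size of `X` during a density boost by the factor `1 + r / m`
is paid for by the increase of the logarithm of the density. -/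
lemma boost_cost_le {m l r E : ℝ} (hl : 4 ≤ l) (hm : E * l ≤ m) (hr : l ≤ r) (hm0 : 0 < m)
    (hE : 1 + r / m ≤ E) : 10 + 9 * √(r + 1) ≤ 34 / √l * m * Real.log (1 + r / m) := by
  set w := √r with hw
  have hr0 : 0 ≤ r := by linarith
  have hw2 : 2 ≤ w := Real.le_sqrt_of_sq_le (by linarith)
  have hww : w ^ 2 = r := Real.sq_sqrt hr0
  have hl0 : 0 < √l := Real.sqrt_pos.2 (by linarith)
  have hlw : √l ≤ w := Real.sqrt_le_sqrt hr
  have hll : √l ^ 2 = l := Real.sq_sqrt (by linarith)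
  have h1 : √(r + 1) ≤ 1.2 * w := Real.sqrt_le_iff.2 ⟨by positivity, by nlinarith⟩
  have hu0 : 0 ≤ r / m := by positivity
  have hrm : r / m * m = r := by field_simp
  have h2 : w * √l ≤ 2 * m * Real.log (1 + r / m) := by
    rcases le_total (r / m) 1 with hu | hu
    · have := half_le_log_one_add hu0 hu
      have : r ≤ 2 * m * Real.log (1 + r / m) := by nlinarith
      nlinarith
    · have h3 : Real.log (1 + 1) ≤ Real.log (1 + r / m) := Real.log_le_log (by norm_num) (by linarith)
      have h4 := half_le_log_one_add zero_le_one le_rfl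
      have h5 : m ≤ 2 * m * Real.log (1 + r / m) := by nlinarith
      refine le_trans ?_ h5
      have h6 : (w * √l) ^ 2 ≤ m ^ 2 := by
        rw [mul_pow, hww, hll]
        have : r ≤ E * m := by nlinarith
        nlinarith
      exact (pow_le_pow_iff_left₀ (by positivity) hm0.le two_ne_zero).1 h6
  calc 10 + 9 * √(r + 1) ≤ 17 * w := by linarith
    _ = 17 * (w * √l) / √l := by field_simp
    _ ≤ 17 * (2 * m * Real.log (1 + r / m)) / √l := by gcongr
    _ = _ := by ring

/-- A state of the book algorithm: in each color `i` a clique `T i`, completely joined in color `i`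
to a reservoir `X` and to a set `Y i` of possible pages, such that each vertex of `X` has degree
at least `d i * |Y i| > p * |Y i|` into `Y i`. -/
structure BookState {V : Type} (H : Bool → SimpleGraph V) (p : ℝ) where
  /-- the reservoir -/
  X : Finset V
  /-- the pages -/
  Y : Bool → Finset V
  /-- the spines -/
  T : Bool → Finset V
  /-- the densities -/
  d : Bool → ℝ
  X_nonempty : X.Nonempty
  Y_nonempty : ∀ i, (Y i).Nonempty
  clique : ∀ i, (H i).IsClique (T i : Set V)
  adj_X : ∀ i, ∀ u ∈ T i, ∀ v ∈ X, (H i).Adj u v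
  adj_Y : ∀ i, ∀ u ∈ T i, ∀ v ∈ Y i, (H i).Adj u v
  lt_d : ∀ i, p < d i
  degree : ∀ i, ∀ x ∈ X, d i * (Y i).card ≤ (nbhd H i x (Y i)).card

namespace BookState

variable {V : Type} {H : Bool → SimpleGraph V} {p : ℝ}

/-- The logarithmic room left for density increments in color `i`. -/
noncomputable def room (S : BookState H p) (i : Bool) : ℝ := -Real.log (S.d i - p)

lemma d_le_one (S : BookState H p) (i : Bool) : S.d i ≤ 1 := by
  obtain ⟨x, hx⟩ := S.X_nonempty
  have h1 := S.degree i x hx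
  have h2 : ((nbhd H i x (S.Y i)).card : ℝ) ≤ (S.Y i).card :=
    Nat.cast_le.2 (Finset.card_le_card (nbhd_subset _ _ _ _))
  have h3 : (0 : ℝ) < (S.Y i).card := by exact_mod_cast (S.Y_nonempty i).card_pos
  by_contra! h
  nlinarith

lemma room_nonneg (S : BookState H p) (hp : 0 < p) (i : Bool) : 0 ≤ S.room i := by
  have := S.d_le_one i
  have := S.lt_d i
  have := Real.log_nonpos (x := S.d i - p) (by linarith) (by linarith)
  unfold room; linarith

variable [DecidableEq V]

/-- The state obtained by restricting the pages of color `i` to the neighbourhood of `x` and the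
reservoir to `X'`, with new density `c` in color `i`. -/
noncomputable def restrict (S : BookState H p) (hp : 0 < p) (i : Bool) (x : V) (hx : x ∈ S.X) (X' : Finset V)
    (hX' : X' ⊆ S.X) (hX0 : X'.Nonempty) (c : ℝ) (hc : p < c)
    (h : ∀ y ∈ X', c * (nbhd H i x (S.Y i)).card ≤ (nbhd H i y (nbhd H i x (S.Y i))).card) :
    BookState H p where
  X := X'
  Y := Function.update S.Y i (nbhd H i x (S.Y i))
  T := S.T
  d := Function.update S.d i c
  X_nonempty := hX0
  Y_nonempty j := by
    by_cases hj : j = i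
    · subst hj
      rw [Function.update_self, ← Finset.card_pos]
      have h1 := S.degree j x hx
      have h2 : (0 : ℝ) < (S.Y j).card := by exact_mod_cast (S.Y_nonempty j).card_pos
      have h3 := S.lt_d j
      have : (0 : ℝ) < (nbhd H j x (S.Y j)).card :=
        lt_of_lt_of_le (mul_pos (hp.trans h3) h2) h1
      exact_mod_cast this
    · rw [Function.update_of_ne hj]; exact S.Y_nonempty j
  clique := S.clique
  adj_X j u hu v hv := S.adj_X j u hu v (hX' hv)
  adj_Y j u hu v hv := by
    by_cases hj : j = i
    · subst hj
      rw [Function.update_self] at hv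
      exact S.adj_Y j u hu v (nbhd_subset _ _ _ _ hv)
    · rw [Function.update_of_ne hj] at hv; exact S.adj_Y j u hu v hv
  lt_d j := by
    by_cases hj : j = i
    · subst hj; rwa [Function.update_self]
    · rw [Function.update_of_ne hj]; exact S.lt_d j
  degree j y hy := by
    by_cases hj : j = i
    · subst hj; rw [Function.update_self, Function.update_self]; exact h y hy
    · rw [Function.update_of_ne hj, Function.update_of_ne hj]; exact S.degree j y (hX' hy)

/-- The state obtained by adding to the spine of color `i` a vertex that is completely joined in
color `i` to the reservoir and to the pages of color `i`. -/
def extend (S : BookState H p) (i : Bool) (x : V) (hT : ∀ u ∈ S.T i, (H i).Adj u x)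
    (hX : ∀ v ∈ S.X, (H i).Adj x v) (hY : ∀ v ∈ S.Y i, (H i).Adj x v) : BookState H p where
  X := S.X
  Y := S.Y
  T := Function.update S.T i (insert x (S.T i))
  d := S.d
  X_nonempty := S.X_nonempty
  Y_nonempty := S.Y_nonempty
  clique j := by
    by_cases hj : j = i
    · subst hj
      rw [Function.update_self, Finset.coe_insert]
      exact (S.clique j).insert fun u hu _ => (hT u hu).symm
    · rw [Function.update_of_ne hj]; exact S.clique j
  adj_X j u hu v hv := by
    by_cases hj : j = i
    · subst hj
      rw [Function.update_self] at hu
      rcases Finset.mem_insert.1 hu with rfl | hu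
      · exact hX v hv
      · exact S.adj_X j u hu v hv
    · rw [Function.update_of_ne hj] at hu; exact S.adj_X j u hu v hv
  adj_Y j u hu v hv := by
    by_cases hj : j = i
    · subst hj
      rw [Function.update_self] at hu
      rcases Finset.mem_insert.1 hu with rfl | hu
      · exact hY v hv
      · exact S.adj_Y j u hu v hv
    · rw [Function.update_of_ne hj] at hu; exact S.adj_Y j u hu v hv
  lt_d := S.lt_d
  degree := S.degree

/-- One step of the book algorithm: either the spine of some color `i` grows by one vertex at a
bounded cost, or the density of some color `i` is boosted, at a cost proportional to the gain. -/
theorem exists_step (S : BookState H p) (hH : ∀ x y, x ≠ y → (H true).Adj x y ∨ (H false).Adj x y)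
    (hp : 0 < p) {m : ℕ} (hm : 2 ≤ m) {l E : ℝ} (hl : 4 ≤ l) (hE : E * l ≤ m)
    (hroom : ∀ i, S.room i ≤ Real.log E) (hE0 : 0 < E)
    (hX : 12 + 9 * √(l + 1) ≤ Real.log S.X.card) :
    ∃ i, ∃ S' : BookState H p, S'.X ⊆ S.X ∧ S'.Y i ⊆ S.Y i ∧ S'.T i ⊆ S.T i ∪ S.X ∧
      S'.T (!i) = S.T (!i) ∧ S'.Y (!i) = S.Y (!i) ∧ S'.room (!i) = S.room (!i) ∧
      p * (S.Y i).card ≤ (S'.Y i).card ∧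
      (((S'.T i).card = (S.T i).card + 1 ∧ S'.room i ≤ S.room i + 2 / m ∧
          Real.log S.X.card - (12 + 9 * √(l + 1)) ≤ Real.log S'.X.card) ∨
        (S'.T i = S.T i ∧ Real.log (1 + l / m) ≤ S.room i - S'.room i ∧
          Real.log S.X.card - 34 / √l * m * (S.room i - S'.room i) ≤ Real.log S'.X.card)) := by
  have hm0 : (0 : ℝ) < m := by positivity
  have hm2 : (2 : ℝ) ≤ m := by exact_mod_cast hm
  set a : Bool → ℝ := fun i => (S.d i - p) / m with ha
  have ha0 : ∀ i, 0 < a i := fun i => div_pos (sub_pos.2 (S.lt_d i)) hm0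
  have ham : ∀ i, a i * m = S.d i - p := fun i => by simp only [ha]; field_simp
  have had : ∀ i, a i ≤ S.d i := fun i => by
    have := ha0 i; have := ham i; nlinarith
  obtain ⟨r, hr, i, x, hx, X', hX', hcard, h1, h2⟩ := exists_density_step H S.X S.X_nonempty S.Y
    S.Y_nonempty S.d a (fun i => hp.trans (S.lt_d i)) ha0 had S.degree
  have hXpos : (0 : ℝ) < S.X.card := by exact_mod_cast S.X_nonempty.card_pos
  have hX'pos : (0 : ℝ) < X'.card := lt_of_lt_of_le (by positivity) hcard
  have hX'0 : X'.Nonempty := Finset.card_pos.1 (by exact_mod_cast hX'pos)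
  have hlogX' : Real.log S.X.card - (10 + 9 * √(r + 1)) ≤ Real.log X'.card := by
    have := Real.log_le_log (by positivity) hcard
    rw [Real.log_mul (Real.exp_ne_zero _) hXpos.ne', Real.log_exp] at this
    linarith
  have hpY : ∀ i, p * (S.Y i).card ≤ (nbhd H i x (S.Y i)).card := fun i =>
    le_trans (by have := S.lt_d i; gcongr) (S.degree i x hx)
  rcases le_total l r with hlr | hlr
  · -- density boost
    have hr0 : 0 ≤ r := by linarith
    set S' := S.restrict hp i x hx X' hX' hX'0 (S.d i + r * a i)
      (by nlinarith [S.lt_d i, ha0 i, mul_nonneg hr0 (ha0 i).le]) h1 with hS'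
    have hd : S'.d i = S.d i + r * a i := Function.update_self ..
    have hu : 0 ≤ r / m := by positivity
    have hgain : S.room i - S'.room i = Real.log (1 + r / m) := by
      have : S'.d i - p = (S.d i - p) * (1 + r / m) := by
        rw [hd, ← ham i]; field_simp; linarith [ham i]
      rw [room, room, this, Real.log_mul (by linarith [S.lt_d i]) (by positivity)]
      ring
    refine ⟨i, S', hX', ?_, Finset.subset_union_left, rfl, ?_, ?_, ?_, Or.inr ⟨rfl, ?_, ?_⟩⟩
    · exact (Function.update_self (f := S.Y) ..).trans_subset (nbhd_subset _ _ _ _)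
    · exact Function.update_of_ne (by simp) ..
    · rw [room, room]
      congr 3
      exact Function.update_of_ne (by simp) ..
    · rw [show S'.Y i = nbhd H i x (S.Y i) from Function.update_self ..]
      exact hpY i
    · rw [hgain]
      exact Real.log_le_log (by positivity) (by gcongr)
    · rw [hgain]
      have hle : 1 + r / m ≤ E := by
        rw [← Real.log_le_log_iff (by positivity) hE0, ← hgain]
        linarith [hroom i, S'.room_nonneg hp i]
      have := boost_cost_le hl hE hlr hm0 hle
      change _ ≤ Real.log X'.card
      linarith
  · -- the spine of the majority color of `x` in `X'` grows
    have hsq : √(r + 1) ≤ √(l + 1) := Real.sqrt_le_sqrt (by linarith)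
    have hboth : ∀ j, ∀ y ∈ X', (S.d j - a j) * (nbhd H j x (S.Y j)).card ≤
        (nbhd H j y (nbhd H j x (S.Y j))).card := by
      intro j y hy
      rcases eq_or_ne j i with rfl | hj
      · refine le_trans ?_ (h1 y hy)
        gcongr
        nlinarith [ha0 j]
      · obtain rfl : j = !i := by cases i <;> cases j <;> simp_all
        exact h2 y hy
    have hlog2 : 2 ≤ Real.log X'.card := by linarith
    have hX'big : (4 : ℝ) ≤ X'.card := by
      have h3 := (Real.le_log_iff_exp_le hX'pos).1 hlog2
      have e2 : Real.exp 2 = Real.exp 1 ^ 2 := by rw [← Real.exp_nat_mul]; norm_num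
      have := Real.exp_one_gt_d9
      nlinarith
    obtain ⟨j, hj⟩ : ∃ j, (X'.card : ℝ) / 4 ≤ (nbhd H j x X').card := by
      by_contra! hcon
      have hsub : X' ⊆ insert x (nbhd H true x X' ∪ nbhd H false x X') := by
        intro y hy
        rcases eq_or_ne y x with rfl | hxy
        · simp
        · rcases hH x y hxy.symm with h | h <;> simp [hy, h]
      have h3 := (Finset.card_le_card hsub).trans (Finset.card_insert_le _ _)
      have h4 := Finset.card_union_le (nbhd H true x X') (nbhd H false x X')
      have h5 : (X'.card : ℝ) ≤ (nbhd H true x X').card + (nbhd H false x X').card + 1 := by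
        exact_mod_cast h3.trans (by omega)
      linarith [hcon true, hcon false]
    set X'' := nbhd H j x X'
    have hX''pos : (0 : ℝ) < X''.card := by linarith
    have hX''0 : X''.Nonempty := Finset.card_pos.1 (by exact_mod_cast hX''pos)
    have hlogX'' : Real.log X'.card - 2 ≤ Real.log X''.card := by
      have h3 := Real.log_le_log (by positivity) hj
      rw [Real.log_div hX'pos.ne' (by norm_num)] at h3
      have h4 : Real.log 4 = 2 * Real.log 2 := by
        rw [show (4 : ℝ) = 2 ^ 2 by norm_num, Real.log_pow]; norm_num
      linarith [Real.log_two_lt_d9]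
    have hpa : p < S.d j - a j := by nlinarith [ha0 j, ham j, S.lt_d j]
    set S₁ := S.restrict hp j x hx X'' ((nbhd_subset _ _ _ _).trans hX') hX''0 (S.d j - a j) hpa
      (fun y hy => hboth j y (nbhd_subset _ _ _ _ hy)) with hS₁
    have hS₁Y : S₁.Y j = nbhd H j x (S.Y j) := Function.update_self ..
    set S' := S₁.extend j x (fun u hu => S.adj_X j u hu x hx)
      (fun v hv => (mem_nbhd.1 (show v ∈ nbhd H j x X' from hv)).2)
      (fun v hv => by rw [hS₁Y] at hv; exact (mem_nbhd.1 hv).2) with hS'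
    have hT : S'.T j = insert x (S.T j) := Function.update_self ..
    have hd : S'.d j = S.d j - a j := Function.update_self ..
    refine ⟨j, S', (nbhd_subset _ _ _ _).trans hX', ?_, ?_, ?_, ?_, ?_, ?_, Or.inl ⟨?_, ?_, ?_⟩⟩
    · exact hS₁Y.trans_subset (nbhd_subset _ _ _ _)
    · rw [hT]
      exact Finset.insert_subset (Finset.mem_union_right _ hx) Finset.subset_union_left
    · exact Function.update_of_ne (by simp) ..
    · exact Function.update_of_ne (by simp) ..
    · rw [room, room]
      congr 3
      exact Function.update_of_ne (by simp) ..
    · rw [show S'.Y j = nbhd H j x (S.Y j) from hS₁Y]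
      exact hpY j
    · rw [hT, Finset.card_insert_of_notMem]
      exact fun hxT => (S.adj_X j x hxT x hx).ne rfl
    · have hq : S'.d j - p = (S.d j - p) * (1 - 1 / m) := by
        rw [hd, ← ham j]; field_simp; rw [show S.d j = a j * m + p by linarith [ham j]]; ring
      have h1m : (1 : ℝ) / m ≤ 1 / 2 := by gcongr
      have hpos : (0 : ℝ) < 1 - 1 / m := by linarith
      have hlog : -(2 / (m : ℝ)) ≤ Real.log (1 - 1 / m) := by
        refine le_trans ?_ (Real.one_sub_inv_le_log_of_pos hpos)
        have hm1 : (0 : ℝ) < m - 1 := by linarith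
        have : (1 - (1 : ℝ) / m)⁻¹ = m / (m - 1) := by field_simp
        rw [this, le_sub_iff_add_le, neg_add_le_iff_le_add, div_le_iff₀ hm1]
        field_simp
        nlinarith
      rw [room, room, hq, Real.log_mul (by linarith [S.lt_d j]) hpos.ne']
      linarith
    · change _ ≤ Real.log X''.card
      linarith

/-- The number of vertices by which the spine of color `i` falls short of `m`. -/
noncomputable def missing (S : BookState H p) (m : ℕ) (i : Bool) : ℝ := (m : ℝ) - (S.T i).card

/-- **Book lemma**: if the reservoir is large in terms of the missing spine vertices and of the room
for density boosts, then one of the spines grows to a clique of size `m`, and its pages shrink by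
little more than a factor `p` for each vertex added. The natural number `n` bounds the number of
steps. -/
theorem exists_book (hH : ∀ x y, x ≠ y → (H true).Adj x y ∨ (H false).Adj x y)
    (hp : 0 < p) (hp1 : p ≤ 1) {m : ℕ} (hm : 2 ≤ m) {l E : ℝ} (hl : 4 ≤ l) (hE0 : 0 < E)
    (hE : E * l ≤ m) {A B k : ℝ} (hB : B = 34 / √l) (hA : A = 12 + 9 * √(l + 1) + 2 * B)
    (hk : k = (Real.log (1 + l / m))⁻¹) (n : ℕ) (S : BookState H p)
    (hT : ∀ i, (S.T i).card ≤ m)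
    (hroom : ∀ i, S.room i + 2 / m * S.missing m i ≤ Real.log E)
    (hn : ∑ i, (S.missing m i * (1 + 2 / m * k) + k * S.room i) ≤ n)
    (hX : ∑ i, (A * S.missing m i + B * m * S.room i) ≤ Real.log S.X.card) :
    ∃ i, ∃ T Y : Finset V, T ⊆ S.T i ∪ S.X ∧ Y ⊆ S.Y i ∧ (H i).IsClique (T : Set V) ∧
      T.card = m ∧ (∀ u ∈ T, ∀ v ∈ Y, (H i).Adj u v) ∧
      (S.Y i).card * p ^ (S.missing m i + k * (S.room i + 2 / m * S.missing m i)) ≤ Y.card := by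
  have hm0 : (0 : ℝ) < m := by positivity
  have hl0 : (0 : ℝ) < l := by linarith
  have hlm : 0 < l / m := by positivity
  have hlog : 0 < Real.log (1 + l / m) := Real.log_pos (by linarith)
  have hk0 : 0 < k := by rw [hk]; positivity
  have hB0 : 0 < B := by rw [hB]; positivity
  have hA0 : 12 + 9 * √(l + 1) ≤ A := by linarith
  have hkl : k * Real.log (1 + l / m) = 1 := by rw [hk, inv_mul_cancel₀ hlog.ne']
  have hsq : 0 ≤ √(l + 1) := Real.sqrt_nonneg _
  have h2m : (0 : ℝ) < 2 / m := by positivity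
  have hBm : 0 < B * m := by positivity
  have hsum : ∀ (i : Bool) (f : Bool → ℝ), ∑ j, f j = f i + f (!i) := by
    intro i f
    cases i <;> simp [add_comm]
  induction n generalizing S with
  | zero =>
    have hmiss : ∀ i, 0 ≤ S.missing m i := fun i => sub_nonneg.2 (Nat.cast_le.2 (hT i))
    by_cases hdone : S.missing m true = 0
    · have hc : (S.T true).card = m := by
        have := sub_eq_zero.1 hdone; exact_mod_cast this.symm
      refine ⟨true, S.T true, S.Y true, Finset.subset_union_left, subset_rfl, S.clique _, hc,
        S.adj_Y true, mul_le_of_le_one_right (by positivity) ?_⟩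
      have := S.room_nonneg hp true
      exact Real.rpow_le_one hp.le hp1 (by rw [hdone]; positivity)
    · exfalso
      have h1 := lt_of_le_of_ne (hmiss true) (Ne.symm hdone)
      have h2 := hmiss false
      have h3 := S.room_nonneg hp true
      have h4 := S.room_nonneg hp false
      rw [hsum true] at hn
      have : 0 < S.missing m true * (1 + 2 / m * k) := by positivity
      have : 0 ≤ S.missing m false * (1 + 2 / m * k) := by positivity
      have : 0 ≤ k * S.room true := by positivity
      have : 0 ≤ k * S.room false := by positivity
      simp only [Bool.not_true] at hn
      push_cast at hn
      linarith
  | succ n ih =>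
    have hmiss : ∀ i, 0 ≤ S.missing m i := fun i => sub_nonneg.2 (Nat.cast_le.2 (hT i))
    have hr0 := S.room_nonneg hp
    by_cases hdone : ∃ i, (S.T i).card = m
    · obtain ⟨i, hc⟩ := hdone
      refine ⟨i, S.T i, S.Y i, Finset.subset_union_left, subset_rfl, S.clique _, hc,
        S.adj_Y i, mul_le_of_le_one_right (by positivity) ?_⟩
      have := hr0 i
      have := hmiss i
      exact Real.rpow_le_one hp.le hp1 (by positivity)
    push Not at hdone
    have hmiss1 : ∀ i, 1 ≤ S.missing m i := fun i => by
      have h1 : (S.T i).card + 1 ≤ m := Nat.lt_of_le_of_ne (hT i) (hdone i)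
      have h2 : ((S.T i).card : ℝ) + 1 ≤ m := by exact_mod_cast h1
      unfold missing; linarith
    have hA1 : 0 < A := by linarith
    obtain ⟨i, S', hSX, hSY, hST, hTn, hYn, hrn, hpY, hcase⟩ := S.exists_step hH hp hm hl hE
      (fun i => by have := mul_nonneg h2m.le (hmiss i); linarith [hroom i]) hE0 (by
        refine hA0.trans (le_trans ?_ hX)
        rw [hsum true]
        have h1 := mul_le_mul_of_nonneg_left (hmiss1 true) hA1.le
        have h2 := mul_nonneg hA1.le (hmiss (!true))
        have h3 := mul_nonneg hBm.le (hr0 true)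
        have h4 := mul_nonneg hBm.le (hr0 (!true))
        linarith)
    have hmn : S'.missing m (!i) = S.missing m (!i) := by simp only [missing, hTn]
    have hbool : ∀ j, j = i ∨ j = !i := fun j => by cases i <;> cases j <;> simp
    rw [hsum i] at hn hX
    push_cast at hn
    -- the quantities of color `i` after the step
    obtain ⟨hTi, hroomi, hni, hXi, hei⟩ : (S'.T i).card ≤ m ∧
        S'.room i + 2 / m * S'.missing m i ≤ S.room i + 2 / m * S.missing m i ∧
        S'.missing m i * (1 + 2 / m * k) + k * S'.room i + 1 ≤
          S.missing m i * (1 + 2 / m * k) + k * S.room i ∧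
        A * S'.missing m i + B * m * S'.room i + (Real.log S.X.card - Real.log S'.X.card) ≤
          A * S.missing m i + B * m * S.room i ∧
        1 + (S'.missing m i + k * (S'.room i + 2 / m * S'.missing m i)) ≤
          S.missing m i + k * (S.room i + 2 / m * S.missing m i) := by
      rcases hcase with ⟨hc, hro, hlX⟩ | ⟨hc, hro, hlX⟩
      · have hmi : S'.missing m i = S.missing m i - 1 := by
          simp only [missing, hc]; push_cast; ring
        have h3 := mul_le_mul_of_nonneg_left hro hk0.le
        have h4 := mul_le_mul_of_nonneg_left hro hBm.le
        have h5 : B * m * (2 / m) = 2 * B := by field_simp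
        have h6 : (S'.T i).card ≤ m := by
          rw [hc]; exact Nat.lt_of_le_of_ne (hT i) (hdone i)
        rw [hmi]
        refine ⟨h6, ?_, ?_, ?_, ?_⟩
        · linarith
        · linarith
        · linarith
        · linarith
      · have hmi : S'.missing m i = S.missing m i := by simp only [missing, hc]
        have h3 := mul_le_mul_of_nonneg_left hro hk0.le
        rw [hkl] at h3
        have h4 := mul_pos hk0 hlog
        rw [← hB] at hlX
        rw [hmi]
        refine ⟨by rw [hc]; exact hT i, ?_, ?_, ?_, ?_⟩
        · linarith
        · linarith
        · linarith
        · linarith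
    obtain ⟨j, T, Y, h1, h2, h3, h4, h5, h6⟩ := ih S'
      (fun j => by
        rcases hbool j with rfl | rfl
        · exact hTi
        · rw [hTn]; exact hT _)
      (fun j => by
        rcases hbool j with rfl | rfl
        · exact hroomi.trans (hroom _)
        · rw [hrn, hmn]; exact hroom _)
      (by rw [hsum i, hrn, hmn]; linarith)
      (by rw [hsum i, hrn, hmn]; linarith)
    refine ⟨j, T, Y, ?_, ?_, h3, h4, h5, le_trans ?_ h6⟩
    · refine h1.trans ?_
      rcases hbool j with rfl | rfl
      · exact Finset.union_subset hST (hSX.trans Finset.subset_union_right)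
      · rw [hTn]; exact Finset.union_subset_union_right hSX
    · rcases hbool j with rfl | rfl
      · exact h2.trans hSY
      · rw [hYn] at h2; exact h2
    · rcases hbool j with rfl | rfl
      · calc _ ≤ ((S.Y j).card : ℝ) * p ^
              (1 + (S'.missing m j + k * (S'.room j + 2 / m * S'.missing m j))) := by
              gcongr ?_ * ?_
              exact Real.rpow_le_rpow_of_exponent_ge hp hp1 hei
          _ = (p * (S.Y j).card) *
                p ^ (S'.missing m j + k * (S'.room j + 2 / m * S'.missing m j)) := by
              rw [Real.rpow_add hp, Real.rpow_one]; ring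
          _ ≤ _ := by gcongr
      · rw [hYn, hmn, hrn]

end BookState

/-! ### The Erdős–Szekeres bound -/

section ErdosSzekeres

variable {V : Type} [DecidableEq V]

lemma card_union_of_adj {G : SimpleGraph V} {s t : Finset V}
    (h : ∀ u ∈ s, ∀ v ∈ t, G.Adj u v) : (s ∪ t).card = s.card + t.card :=
  Finset.card_union_of_disjoint (Finset.disjoint_left.2 fun u hs ht => (h u hs u ht).ne rfl)

lemma isClique_union_of_adj {G : SimpleGraph V} {s t : Finset V} (hs : G.IsClique (s : Set V))
    (ht : G.IsClique (t : Set V)) (h : ∀ u ∈ s, ∀ v ∈ t, G.Adj u v) :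
    G.IsClique ((s ∪ t : Finset V) : Set V) := by
  intro u hu v hv huv
  simp only [Finset.coe_union, Set.mem_union, Finset.mem_coe] at hu hv
  rcases hu with hu | hu <;> rcases hv with hv | hv
  · exact hs hu hv huv
  · exact h u hu v hv
  · exact (h v hv u hu).symm
  · exact ht hu hv huv

/-- The Erdős–Szekeres bound, for an arbitrary one of the two colors in the role of red. -/
theorem card_lt_choose_of_clique_card_le {H : Bool → SimpleGraph V}
    (hH : ∀ x y, x ≠ y → (H true).Adj x y ∨ (H false).Adj x y) (i : Bool) (n : ℕ) {a b : ℕ}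
    (hab : a + b = n) {U : Finset V}
    (ha : ∀ s ⊆ U, (H i).IsClique (s : Set V) → s.card ≤ a)
    (hb : ∀ s ⊆ U, (H (!i)).IsClique (s : Set V) → s.card ≤ b) :
    U.card < n.choose a := by
  induction n generalizing a b U with
  | zero =>
    obtain ⟨rfl, rfl⟩ : a = 0 ∧ b = 0 := by omega
    rcases U.eq_empty_or_nonempty with rfl | ⟨v, hv⟩
    · simp
    · have := ha {v} (by simpa using hv) (by simp)
      simp at this
  | succ n ih =>
    rcases U.eq_empty_or_nonempty with rfl | ⟨v, hv⟩
    · simpa using Nat.choose_pos (by omega)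
    have ha1 := ha {v} (by simpa using hv) (by simp)
    have hb1 := hb {v} (by simpa using hv) (by simp)
    simp only [Finset.card_singleton] at ha1 hb1
    obtain ⟨a, rfl⟩ : ∃ a', a = a' + 1 := ⟨a - 1, by omega⟩
    obtain ⟨b, rfl⟩ : ∃ b', b = b' + 1 := ⟨b - 1, by omega⟩
    have hsub : U ⊆ insert v (nbhd H i v U ∪ nbhd H (!i) v U) := by
      intro y hy
      rcases eq_or_ne y v with rfl | hyv
      · simp
      · rcases hH v y hyv.symm with h | h <;> cases i <;> simp [hy, h]
    have h1 := (Finset.card_le_card hsub).trans (Finset.card_insert_le _ _)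
    have h2 := Finset.card_union_le (nbhd H i v U) (nbhd H (!i) v U)
    have key : ∀ j, ∀ s ⊆ nbhd H j v U, (H j).IsClique (s : Set V) →
        insert v s ⊆ U ∧ (H j).IsClique ((insert v s : Finset V) : Set V) ∧
          (insert v s).card = s.card + 1 := by
      intro j s hs hcl
      refine ⟨Finset.insert_subset hv (hs.trans (nbhd_subset _ _ _ _)), ?_, ?_⟩
      · rw [Finset.coe_insert]
        exact hcl.insert fun u hu _ => (mem_nbhd.1 (hs hu)).2
      · exact Finset.card_insert_of_notMem fun hvs => (mem_nbhd.1 (hs hvs)).2.ne rfl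
    have h3 := ih (a := a) (b := b + 1) (U := nbhd H i v U) (by omega)
      (fun s hs hcl => by
        obtain ⟨k1, k2, k3⟩ := key i s hs hcl
        have := ha _ k1 k2; omega)
      (fun s hs hcl => hb s (hs.trans (nbhd_subset _ _ _ _)) hcl)
    have h4 := ih (a := a + 1) (b := b) (U := nbhd H (!i) v U) (by omega)
      (fun s hs hcl => ha s (hs.trans (nbhd_subset _ _ _ _)) hcl)
      (fun s hs hcl => by
        obtain ⟨k1, k2, k3⟩ := key (!i) s hs hcl
        have := hb _ k1 k2; omega)
    rw [Nat.choose_succ_succ']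
    omega

/-- Starting from all vertices and repeatedly passing to a neighbourhood of relative size at least
`c`, one reaches a set in which every vertex has smaller degree in both colors. -/
theorem exists_start [Fintype V] (H : Bool → SimpleGraph V) {c : ℝ} (hc : 0 ≤ c) :
    ∃ (U : Finset V) (W : Bool → Finset V), (∀ i, (H i).IsClique (W i : Set V)) ∧
      (∀ i, ∀ u ∈ W i, ∀ v ∈ U, (H i).Adj u v) ∧
      c ^ ((W true).card + (W false).card) * Fintype.card V ≤ U.card ∧
      ∀ i, ∀ v ∈ U, ((nbhd H i v U).card : ℝ) < c * U.card := by
  classical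
  let P : Finset (Finset V × (Bool → Finset V)) := Finset.univ.filter fun q =>
    (∀ i, (H i).IsClique (q.2 i : Set V)) ∧ (∀ i, ∀ u ∈ q.2 i, ∀ v ∈ q.1, (H i).Adj u v) ∧
      c ^ ((q.2 true).card + (q.2 false).card) * Fintype.card V ≤ q.1.card
  have hP : P.Nonempty := ⟨(Finset.univ, fun _ => ∅), by simp [P]⟩
  obtain ⟨⟨U, W⟩, hq, hmax⟩ :=
    P.exists_max_image (fun q => (q.2 true).card + (q.2 false).card) hP
  obtain ⟨h1, h2, h3⟩ := (Finset.mem_filter.1 hq).2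
  refine ⟨U, W, h1, h2, h3, fun i v hv => ?_⟩
  by_contra! hcon
  have hvW : v ∉ W i := fun h => (h2 i v h v hv).ne rfl
  set W' := Function.update W i (insert v (W i)) with hW'
  have hcard : (W' true).card + (W' false).card = (W true).card + (W false).card + 1 := by
    have := Finset.card_insert_of_notMem hvW
    cases i <;> simp only [hW', Function.update_self, ne_eq, reduceCtorEq, not_false_eq_true,
      Function.update_of_ne, this] <;> omega
  have hmem : (nbhd H i v U, W') ∈ P := by
    refine Finset.mem_filter.2 ⟨Finset.mem_univ _, fun j => ?_, fun j u hu w hw => ?_, ?_⟩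
    · rcases eq_or_ne j i with rfl | hj
      · simp only [hW', Function.update_self, Finset.coe_insert]
        exact (h1 j).insert fun u hu _ => (h2 j u hu v hv).symm
      · simp only [hW', Function.update_of_ne hj]; exact h1 j
    · have hwU := nbhd_subset _ _ _ _ hw
      rcases eq_or_ne j i with rfl | hj
      · simp only [hW', Function.update_self, Finset.mem_insert] at hu
        rcases hu with rfl | hu
        · exact (mem_nbhd.1 hw).2
        · exact h2 j u hu w hwU
      · simp only [hW', Function.update_of_ne hj] at hu; exact h2 j u hu w hwU
    · simp only [hcard]
      calc _ = c * (c ^ ((W true).card + (W false).card) * Fintype.card V) := by ring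
        _ ≤ c * U.card := by gcongr
        _ ≤ _ := hcon
  have := hmax _ hmem
  simp only [hcard] at this
  omega

end ErdosSzekeres

/-! ### Exponential improvement of the Erdős–Szekeres bound -/

lemma log_choose_le (j l : ℕ) {h : ℝ} (h0 : 0 < h) (h1 : h ≤ 1 / 2) :
    Real.log ((j + l).choose j) ≤
      (j + l) * Real.log 2 - h * (j - l) + 2 * h ^ 2 * (j + l) := by
  have hpos : (0 : ℝ) < (j + l).choose j := by exact_mod_cast Nat.choose_pos (Nat.le_add_right _ _)
  have hp : 0 < (1 + h) / 2 := by linarith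
  have hq : 0 < (1 - h) / 2 := by linarith
  have hle : ((1 + h) / 2) ^ j * ((1 - h) / 2) ^ l * (j + l).choose j ≤ 1 := by
    have := add_pow ((1 + h) / 2) ((1 - h) / 2) (j + l)
    rw [show (1 + h) / 2 + (1 - h) / 2 = 1 by ring, one_pow] at this
    refine (le_trans (le_of_eq ?_) (Finset.single_le_sum (f := fun m => ((1 + h) / 2) ^ m *
      ((1 - h) / 2) ^ (j + l - m) * ((j + l).choose m : ℝ)) (fun m _ => by positivity)
      (Finset.mem_range.2 (show j < j + l + 1 by omega)))).trans_eq this.symm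
    simp
  have hlog := Real.log_nonpos (by positivity) hle
  rw [Real.log_mul (by positivity) hpos.ne', Real.log_mul (by positivity) (by positivity),
    Real.log_pow, Real.log_pow, Real.log_div (by linarith) two_ne_zero,
    Real.log_div (by linarith) two_ne_zero] at hlog
  have e1 : h - h ^ 2 ≤ Real.log (1 + h) := by
    refine le_trans ?_ (Real.one_sub_inv_le_log_of_pos (by linarith))
    rw [le_sub_iff_add_le, inv_eq_one_div, ← le_sub_iff_add_le', div_le_iff₀ (by linarith)]
    nlinarith [pow_pos h0 3]
  have e2 : -h - 2 * h ^ 2 ≤ Real.log (1 - h) := by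
    refine le_trans ?_ (Real.one_sub_inv_le_log_of_pos (by linarith))
    rw [le_sub_iff_add_le, inv_eq_one_div, ← le_sub_iff_add_le', div_le_iff₀ (by linarith)]
    nlinarith [pow_pos h0 2]
  have hj : (0 : ℝ) ≤ j := by positivity
  have hl : (0 : ℝ) ≤ l := by positivity
  have f1 := mul_le_mul_of_nonneg_left e1 hj
  have f2 := mul_le_mul_of_nonneg_left e2 hl
  nlinarith [mul_nonneg hj (sq_nonneg h)]

lemma reservoir_numerics {t m x L : ℝ} (hx : x ≤ 2 ^ 24 + 1) (hL : L ≤ 0.6931471808) (hm : 0 ≤ m)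
    (hmt : m ≤ t / 2 ^ 32) :
    (12 + 9 * x + 2 * (34 / 2 ^ 24)) * m + 34 / 2 ^ 24 * m * (44 * L) +
      ((12 + 9 * x + 2 * (34 / 2 ^ 24)) * m + 34 / 2 ^ 24 * m * (44 * L)) ≤ t := by
  have h1 := mul_le_mul_of_nonneg_right hx hm
  have h2 := mul_le_mul_of_nonneg_right hL hm
  have h3 : t = t / 2 ^ 32 * 2 ^ 32 := by field_simp
  rw [h3]
  linarith

/-- The numerical contradiction between the lower bound for the pages of a book with a spine of size
`m` and the Erdős–Szekeres upper bound. Here `s` is the number of vertices used up before the book,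
`u` and `y` are the logarithms of the sizes of the set containing the book and of its pages. -/
lemma book_numerics {t M s m u y η h : ℝ} (ht : 2 ^ 140 ≤ t)
    (hM : M ≤ (1 + 1 / 2 ^ 90) * t) (hm1 : m ≤ t / 2 ^ 32) (hm2 : t / 2 ^ 32 - 1 ≤ m)
    (hη : η ≤ 1 / 2 ^ 39) (hh : h = 1 / 2 ^ 36) (hst : s ≤ t / 2 ^ 44)
    (hu : 2 * t * Real.log 2 - s * Real.log 2 ≤ u) (hy : u - m * (Real.log 2 + η) ≤ y)
    (hy' : y ≤ (2 * M - s - m) * Real.log 2 - h * (m - s) + 2 * h ^ 2 * (2 * M)) : False := by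
  have l1 := Real.log_two_lt_d9
  have l2 := Real.log_two_gt_d9
  have h1 : h * (m - s) ≤ 2 * (M - t) * Real.log 2 + m * η + 4 * h ^ 2 * M := by linarith
  have h2 : 2 * (M - t) * Real.log 2 ≤ 2 * (t / 2 ^ 90) := by
    have : M - t ≤ t / 2 ^ 90 := by linarith
    nlinarith
  have hm0 : 0 ≤ m := by linarith
  have h3 : m * η ≤ t / 2 ^ 32 * (1 / 2 ^ 39) :=
    (mul_le_mul_of_nonneg_left hη hm0).trans (mul_le_mul_of_nonneg_right hm1 (by positivity))
  subst hh
  linarith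

set_option maxHeartbeats 1000000 in
/-- **Exponential improvement of the diagonal Ramsey bound**: in a two-coloring of a complete graph
on `2 ^ (2 * t)` vertices, `t` large, some monochromatic clique has more than `(1 + 2⁻⁹⁰) t`
vertices. -/
theorem exists_large_clique {V : Type} [Fintype V] [DecidableEq V] {H : Bool → SimpleGraph V}
    (hH : ∀ x y, x ≠ y → (H true).Adj x y ∨ (H false).Adj x y) {t : ℕ} (ht : 2 ^ 140 ≤ t)
    (hV : Fintype.card V = 2 ^ (2 * t)) :
    ∃ i, ∃ s : Finset V, (H i).IsClique (s : Set V) ∧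
      (1 + 1 / 2 ^ 90 : ℝ) * t < s.card := by
  by_contra! hcon
  have htR : (2 : ℝ) ^ 140 ≤ t := by exact_mod_cast ht
  obtain ⟨M, hM⟩ : ∃ M, M = ⌊(1 + 1 / 2 ^ 90 : ℝ) * t⌋₊ := ⟨_, rfl⟩
  have hMR : (M : ℝ) ≤ (1 + 1 / 2 ^ 90) * t := by
    rw [hM]; exact Nat.floor_le (by positivity)
  have hcl : ∀ i, ∀ s : Finset V, (H i).IsClique (s : Set V) → s.card ≤ M :=
    fun i s hs => by rw [hM]; exact Nat.le_floor (hcon i s hs)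
  obtain ⟨ε, hε⟩ : ∃ ε : ℝ, ε = 1 / 2 ^ 44 := ⟨_, rfl⟩
  obtain ⟨U, W, hW, hWU, hUcard, hdeg⟩ := exists_start H (c := 1 / 2 + ε) (by positivity)
  obtain ⟨s, hs⟩ : ∃ s, s = (W true).card + (W false).card := ⟨_, rfl⟩
  rw [← hs] at hUcard
  have l1 := Real.log_two_lt_d9
  have l2 := Real.log_two_gt_d9
  rw [hV] at hUcard
  push_cast at hUcard
  have hUpos : (0 : ℝ) < U.card := lt_of_lt_of_le (by positivity) hUcard
  have hU0 : U.Nonempty := Finset.card_pos.1 (by exact_mod_cast hUpos)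
  obtain ⟨u, hu⟩ : ∃ u, u = Real.log U.card := ⟨_, rfl⟩
  -- the size of `U` from below, and from above by the Erdős–Szekeres bound
  have hu1 : s * (-Real.log 2 + ε) + 2 * t * Real.log 2 ≤ u := by
    have h1 := Real.log_le_log (by positivity) hUcard
    rw [← hu, Real.log_mul (by positivity) (by positivity), Real.log_pow, Real.log_pow] at h1
    have h2 : -Real.log 2 + ε ≤ Real.log (1 / 2 + ε) := by
      have h3 := half_le_log_one_add (u := 2 * ε) (by positivity) (by norm_num [hε])
      rw [show 1 / 2 + ε = (1 + 2 * ε) / 2 by ring, Real.log_div (by positivity) two_ne_zero]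
      linarith
    have h4 := mul_le_mul_of_nonneg_left h2 (Nat.cast_nonneg (α := ℝ) s)
    push_cast at h1
    linarith
  have hWM : ∀ i, ∀ q ⊆ U, (H i).IsClique (q : Set V) → q.card + (W i).card ≤ M := by
    intro i q hq hqc
    have hadj : ∀ x ∈ W i, ∀ v ∈ q, (H i).Adj x v := fun x hx v hv => hWU i x hx v (hq hv)
    have := hcl i _ (isClique_union_of_adj (hW i) hqc hadj)
    rw [card_union_of_adj hadj] at this
    omega
  have hW0 : ∀ i, (W i).card ≤ M := fun i => by
    simpa using hWM i ∅ (by simp) (by simp)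
  have hu2 : u ≤ (2 * M - s) * Real.log 2 := by
    have h1 := card_lt_choose_of_clique_card_le hH true _ rfl (a := M - (W true).card)
      (b := M - (W false).card) (U := U) (fun q hq hqc => by have := hWM true q hq hqc; omega)
      (fun q hq hqc => by have := hWM false q hq hqc; omega)
    have h2 := h1.le.trans (Nat.choose_le_two_pow _ _)
    have h3 : (U.card : ℝ) ≤ 2 ^ (M - (W true).card + (M - (W false).card)) := by exact_mod_cast h2
    have h4 := Real.log_le_log hUpos h3
    rw [← hu, Real.log_pow] at h4
    push_cast [Nat.cast_sub (hW0 true), Nat.cast_sub (hW0 false)] at h4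
    rw [hs]
    push_cast
    linarith
  have hsR : (0 : ℝ) ≤ s := Nat.cast_nonneg _
  have hst : (s : ℝ) ≤ t / 2 ^ 44 := by
    have h1 : s * ε ≤ 2 * (M - t) * Real.log 2 := by linarith
    have h2 : (M : ℝ) - t ≤ t / 2 ^ 90 := by linarith
    have h3 : 2 * ((M : ℝ) - t) * Real.log 2 ≤ 2 * (t / 2 ^ 90) := by
      have : (0 : ℝ) ≤ t / 2 ^ 90 := by positivity
      nlinarith
    rw [hε] at h1
    linarith
  have hut : (t : ℝ) ≤ u := by
    have : (s : ℝ) * Real.log 2 ≤ t / 2 ^ 44 := by nlinarith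
    have : 0 ≤ s * ε := by positivity
    nlinarith
  -- The book has spine size `m ≈ 2⁻³² t`, so the Erdős–Szekeres bound for its pages is off by about
  -- `exp (2⁻⁶⁸ t)`. The losses from the densities (`ε = 2⁻⁴⁴`), from the boosts (threshold
  -- `l = 2⁴⁸`) and from the start are of smaller order, while the reservoir needs only
  -- `m √l ≈ 2⁻⁸ t` on the logarithmic scale.
  obtain ⟨m, hm⟩ : ∃ m, m = ⌊(t : ℝ) / 2 ^ 32⌋₊ := ⟨_, rfl⟩
  have hm1 : (m : ℝ) ≤ t / 2 ^ 32 := by rw [hm]; exact Nat.floor_le (by positivity)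
  have hm2 : (t : ℝ) / 2 ^ 32 - 1 ≤ m := by
    rw [hm]; linarith [Nat.lt_floor_add_one ((t : ℝ) / 2 ^ 32)]
  have hmbig : (2 : ℝ) ^ 100 ≤ m := by linarith
  have hm0 : (0 : ℝ) < m := by linarith [pow_pos (two_pos (α := ℝ)) 100]
  have hdegU : ∀ i, ∀ x ∈ U, (1 / 2 - 2 * ε) * U.card ≤ (nbhd H i x U).card := by
    intro i x hx
    have hsub : U ⊆ insert x (nbhd H i x U ∪ nbhd H (!i) x U) := by
      intro y hy
      rcases eq_or_ne y x with rfl | hyx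
      · simp
      · rcases hH x y hyx.symm with h | h <;> cases i <;> simp [hy, h]
    have h1 := (Finset.card_le_card hsub).trans (Finset.card_insert_le _ _)
    have h2 := Finset.card_union_le (nbhd H i x U) (nbhd H (!i) x U)
    have h3 : (U.card : ℝ) ≤ (nbhd H i x U).card + (nbhd H (!i) x U).card + 1 := by
      exact_mod_cast h1.trans (by omega)
    have h4 := hdeg (!i) x hx
    have h5 : 1 ≤ ε * U.card := by
      have h6 : (t : ℝ) ≤ U.card := by
        have := Real.add_one_le_exp u
        rw [hu, Real.exp_log hUpos] at this
        linarith
      rw [hε]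
      linarith
    linarith
  let S : BookState H (1 / 2 - 3 * ε) :=
    { X := U
      Y := fun _ => U
      T := fun _ => ∅
      d := fun _ => 1 / 2 - 2 * ε
      X_nonempty := hU0
      Y_nonempty := fun _ => hU0
      clique := by simp
      adj_X := by simp
      adj_Y := by simp
      lt_d := fun _ => by have : 0 < ε := by positivity
                          linarith
      degree := hdegU }
  have hroom : ∀ i, S.room i = 44 * Real.log 2 := fun i => by
    have : S.d i - (1 / 2 - 3 * ε) = ((2 : ℝ) ^ 44)⁻¹ := by
      change 1 / 2 - 2 * ε - (1 / 2 - 3 * ε) = _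
      rw [hε]; norm_num
    rw [BookState.room, this, Real.log_inv, Real.log_pow]; norm_num
  have hmiss : ∀ i, S.missing m i = m := fun i => by simp [BookState.missing, S]
  have hlogE : Real.log (Real.exp 2 * 2 ^ 44) = 2 + 44 * Real.log 2 := by
    rw [Real.log_mul (Real.exp_ne_zero _) (by positivity), Real.log_exp, Real.log_pow]; norm_num
  have he2 : Real.exp 2 ≤ 8 := by
    have e2 : Real.exp 2 = Real.exp 1 ^ 2 := by rw [← Real.exp_nat_mul]; norm_num
    have := Real.exp_one_lt_d9
    have := Real.exp_pos 1
    rw [e2]; nlinarith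
  have hsqrt : √((2 : ℝ) ^ 48) = 2 ^ 24 := by
    rw [show (2 : ℝ) ^ 48 = (2 ^ 24) ^ 2 by norm_num]; exact Real.sqrt_sq (by positivity)
  have hsqrt' : √((2 : ℝ) ^ 48 + 1) ≤ 2 ^ 24 + 1 := Real.sqrt_le_iff.2 (by norm_num)
  obtain ⟨k, hk⟩ : ∃ k, k = (Real.log (1 + (2 : ℝ) ^ 48 / m))⁻¹ := ⟨_, rfl⟩
  have hk1 : k ≤ m / 2 ^ 47 := by
    have h1 : (2 : ℝ) ^ 48 / m ≤ 1 := (div_le_one hm0).2 (by linarith)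
    have h2 := half_le_log_one_add (u := (2 : ℝ) ^ 48 / m) (by positivity) h1
    have h3 := inv_anti₀ (by positivity) h2
    rw [hk]
    refine h3.trans (le_of_eq ?_)
    field_simp
  have hk0 : 0 ≤ k := by
    rw [hk]
    refine inv_nonneg.2 (Real.log_nonneg ?_)
    have : (0 : ℝ) ≤ 2 ^ 48 / m := by positivity
    linarith
  have h2m : 2 / (m : ℝ) * m = 2 := by field_simp
  obtain ⟨n, hn⟩ := exists_nat_ge
    (∑ i, (S.missing m i * (1 + 2 / m * k) + k * S.room i))
  obtain ⟨i, T, Y, hT, hY, hTc, hTm, hTY, hcard⟩ := BookState.exists_book hH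
    (by rw [hε]; norm_num) (by rw [hε]; norm_num) (m := m)
    (by exact_mod_cast (show (2 : ℝ) ≤ m by linarith)) (l := 2 ^ 48) (by norm_num)
    (E := Real.exp 2 * 2 ^ 44) (by positivity) (by nlinarith) rfl rfl hk n S (by simp [S])
    (fun i => by rw [hroom, hmiss, hlogE, h2m]; linarith) hn (by
      simp only [hroom, hmiss, hsqrt]
      rw [Fintype.sum_bool]
      change _ ≤ Real.log U.card
      rw [← hu]
      refine le_trans ?_ hut
      exact reservoir_numerics hsqrt' l1.le hm0.le hm1)
  -- the pages are too many for the Erdős–Szekeres bound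
  have hTU : T ⊆ U := by simpa [S] using hT
  have hYU : Y ⊆ U := hY
  rw [hroom, hmiss, h2m] at hcard
  obtain ⟨e, he⟩ : ∃ e, e = (m : ℝ) + k * (44 * Real.log 2 + 2) := ⟨_, rfl⟩
  rw [← he] at hcard
  have hp : (0 : ℝ) < 1 / 2 - 3 * ε := by rw [hε]; norm_num
  have hcard' : (U.card : ℝ) * (1 / 2 - 3 * ε) ^ e ≤ Y.card := hcard
  have hYpos : (0 : ℝ) < Y.card := lt_of_lt_of_le (by positivity) hcard'
  have hy : u + e * Real.log (1 / 2 - 3 * ε) ≤ Real.log Y.card := by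
    have := Real.log_le_log (by positivity) hcard'
    rwa [Real.log_mul hUpos.ne' (by positivity), Real.log_rpow hp, ← hu] at this
  have hlogp : -Real.log 2 - 12 * ε ≤ Real.log (1 / 2 - 3 * ε) := by
    rw [show 1 / 2 - 3 * ε = (1 - 6 * ε) / 2 by ring,
      Real.log_div (by rw [hε]; norm_num) two_ne_zero]
    have := Real.one_sub_inv_le_log_of_pos (show 0 < 1 - 6 * ε by rw [hε]; norm_num)
    have h2 : (1 - 6 * ε)⁻¹ ≤ 1 + 12 * ε := by
      rw [inv_le_iff_one_le_mul₀ (by rw [hε]; norm_num), hε]; norm_num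
    linarith
  have he0 : 0 ≤ e := by rw [he]; positivity
  have he1 : e ≤ m + m / 2 ^ 47 * 33 := by
    have : k * (44 * Real.log 2 + 2) ≤ m / 2 ^ 47 * 33 := by
      gcongr
      linarith
    linarith
  have hadj : ∀ x ∈ W i, ∀ v ∈ T, (H i).Adj x v := fun x hx v hv => hWU i x hx v (hTU hv)
  have hmM : (W i).card + m ≤ M := by
    have := hWM i T hTU hTc
    omega
  have hsi : s = (W i).card + (W (!i)).card := by cases i <;> simp [hs, add_comm]
  have hES := card_lt_choose_of_clique_card_le hH (!i) _ rfl (a := M - (W (!i)).card)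
    (b := M - (W i).card - m) (U := Y)
    (fun q hq hqc => by have := hWM (!i) q (hq.trans hYU) hqc; omega)
    (fun q hq hqc => by
      rw [Bool.not_not] at hqc
      have hTq : ∀ x ∈ T, ∀ v ∈ q, (H i).Adj x v := fun x hx v hv => hTY x hx v (hq hv)
      have := hWM i (T ∪ q) (Finset.union_subset hTU (hq.trans hYU))
        (isClique_union_of_adj hTc hqc hTq)
      rw [card_union_of_adj hTq] at this
      omega)
  have hES' : Real.log Y.card ≤ _ := (Real.log_le_log hYpos (Nat.cast_le.2 hES.le)).trans
    (log_choose_le _ _ (h := 1 / 2 ^ 36) (by norm_num) (by norm_num))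
  rw [Nat.sub_sub, Nat.cast_sub hmM, Nat.cast_sub (hW0 _)] at hES'
  push_cast at hES'
  have hsiR : (s : ℝ) = (W i).card + (W (!i)).card := by exact_mod_cast hsi
  have hWi : (0 : ℝ) ≤ (W i).card := Nat.cast_nonneg _
  have hWni : (0 : ℝ) ≤ (W (!i)).card := Nat.cast_nonneg _
  refine book_numerics (t := t) (M := M) (s := s) (m := m) (u := u) (y := Real.log Y.card)
    (η := 1 / 2 ^ 39) (h := 1 / 2 ^ 36) htR hMR hm1 hm2 le_rfl rfl hst ?_ ?_ ?_
  · have : 0 ≤ s * ε := by positivity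
    linarith
  · have h1 : e * (Real.log 2 + 12 * ε) ≤ (m + m / 2 ^ 47 * 33) * (Real.log 2 + 12 * ε) := by
      gcongr
    have h2 := mul_le_mul_of_nonneg_left hlogp he0
    have h3 : (m : ℝ) / 2 ^ 47 * 33 * (Real.log 2 + 12 * ε) ≤ m / 2 ^ 47 * 33 * 1 := by
      gcongr
      rw [hε]; linarith
    have h4 : (m : ℝ) * ε ≤ m / 2 ^ 44 := by rw [hε]; linarith
    linarith
  · rw [hsiR]
    linarith

/-! ### Two-colorings of complete graphs -/

lemma exists_labelGraph_adj {n : ℕ} (G : TwoColoring n) {x y : Fin n} (h : x ≠ y) :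
    (SimpleGraph.EdgeLabeling.labelGraph G true).Adj x y ∨
      (SimpleGraph.EdgeLabeling.labelGraph G false).Adj x y := by
  have hadj : (⊤ : SimpleGraph (Fin n)).Adj x y := h
  simp only [SimpleGraph.EdgeLabeling.labelGraph_adj]
  cases hc : G.get x y hadj
  · exact Or.inr ⟨hadj, hc⟩
  · exact Or.inl ⟨hadj, hc⟩

lemma card_le_maxMonoCliqueSize {n : ℕ} {G : TwoColoring n} {c : Bool} {s : Finset (Fin n)}
    (hs : IsMonoClique G c s) : s.card ≤ maxMonoCliqueSize G := by
  have := SimpleGraph.IsClique.card_le_cliqueNum (t := s) (tc := hs)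
  cases c
  · exact this.trans (le_max_right _ _)
  · exact this.trans (le_max_left _ _)

theorem one_add_mul_lt_maxMonoCliqueSize {t : ℕ} (ht : 2 ^ 140 ≤ t)
    (G : TwoColoring (2 ^ (2 * t))) : (1 + 1 / 2 ^ 90 : ℝ) * t < maxMonoCliqueSize G := by
  obtain ⟨c, s, hs, hlt⟩ := exists_large_clique
    (H := fun c => SimpleGraph.EdgeLabeling.labelGraph G c)
    (fun _ _ h => exists_labelGraph_adj G h) ht (by simp)
  exact hlt.trans_le (Nat.cast_le.2 (card_le_maxMonoCliqueSize (c := c) hs))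

theorem mainTheorem2 :
    ∀ ε : ℝ, 0 < ε → ∃ δ : ℝ, 0 < δ ∧ ∃ t₀ : ℕ, ∀ t : ℕ, t₀ ≤ t →
      ∀ G : TwoColoring (2 ^ (2 * t)),
        |(maxMonoCliqueSize G : ℝ) - (t : ℝ)| ≤ δ * (t : ℝ) →
        ∃ c : Bool,
          (2 : ℝ) ^ ((1 / 2 : ℝ) * (4 - Real.logb 2 (Real.exp 1) - ε) * (t : ℝ) ^ 2)
              ≤ (monoCliqueCount G c (t : ℝ) : ℝ) ∧
          (2 : ℝ) ^ ((1 / 2 : ℝ) * (4 - Real.logb 2 (Real.exp 1) - ε) * (t : ℝ) ^ 2)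
              ≤ (monoCliqueCount G (!c) ((1 - ε) * (t : ℝ)) : ℝ) := by
  intro ε _
  refine ⟨1 / 2 ^ 90, by positivity, 2 ^ 140, fun t ht G hG => ?_⟩
  -- the hypothesis is incompatible with the exponential improvement for these `t`
  have h1 := one_add_mul_lt_maxMonoCliqueSize ht G
  have h2 := (abs_le.1 hG).2
  linarith
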